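/- Let $n$ be a non-zero integer. For non-zero integers $a,b,c$, not all of the same sign, let $\mathbf{X}_{a,b,c}\subseteq\mathbb{A}^3_{\mathbb{Z}}$ be the surface $ax^2+by^2+cz^2=n$, with height $\max\{|a|,|b|,|c|\}$. For real $B\ge 1$ let $N(B)$ be the number of these surfaces of height at most $B$, and let $N_{\mathrm{loc}}(B)$ be the number of those which in addition satisfy $\mathbf{X}_{a,b,c}(\mathbf{A})=X_{a,b,c}(\mathbb{R})\times\prod_p\mathbf{X}_{a,b,c}(\mathbb{Z}_p)\neq\emptyset$. Put $$I=\{(a,b,c)\in[-1,1]^3: abc\neq 0,\ a,b,c\text{ not all of the same sign}\},$$ $$\Omega_\infty=\{(a,b,c)\in I:\ ax^2+by^2+cz^2=n\text{ has a real solution}\},$$ $$\Omega_p=\{(a,b,c)\in\mathbb{Z}_p^3:\ ax^2+by^2+cz^2=n\text{ has a solution in }\mathbb{Z}_p^3\},$$ and $\sigma_\infty=\mu_\infty(\Omega_\infty)/\mu_\infty(I)$, $\sigma_p=\mu_p(\Omega_p)$, where $\mu_\infty$ is the Lebesgue measure on $\mathbb{R}^3$ and $\mu_p$ is the Haar measure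 on $\mathbb{Z}_p^3$ with $\mu_p(\mathbb{Z}_p^3)=1$. Then the product $\prod_p\sigma_p$ converges, $\sigma_\infty\prod_p\sigma_p\neq 0$, and $$\lim_{B\to\infty}\frac{N_{\mathrm{loc}}(B)}{N(B)}=\sigma_\infty\prod_p\sigma_p,\qquad \lim_{B\to\infty}\frac{N_{\mathrm{loc}}(B)}{B^3}=\mu_\infty(I)\,\sigma_\infty\prod_p\sigma_p,\qquad \mu_\infty(I)=6.$$ Moreover $\sigma_\infty=1$; for every prime $p>2$ with $p\nmid n$ we have $\sigma_p=1-\tfrac32p^{-2}+\tfrac12p^{-3}$; and if $n$ is odd, then $\sigma_2=\tfrac{357}{512}$. -/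

import Mathlib

open MeasureTheory Filter Topology

/-- The solutions over the ring `R` of the equation `a x² + b y² + c z² = n`. -/
def quadricPoints {R : Type*} [CommRing R] (a b c n : R) : Set (R × R × R) :=
  {v | a * v.1 ^ 2 + b * v.2.1 ^ 2 + c * v.2.2 ^ 2 = n}

/-- `a`, `b`, `c` are all non-zero and not all of the same sign. -/
def IsAdmissible {R : Type*} [CommRing R] [LinearOrder R] (a b c : R) : Prop :=
  (a ≠ 0 ∧ b ≠ 0 ∧ c ≠ 0) ∧ ¬(0 < a ∧ 0 < b ∧ 0 < c) ∧ ¬(a < 0 ∧ b < 0 ∧ c < 0)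

instance primesFact (p : Nat.Primes) : Fact (p : ℕ).Prime := ⟨p.2⟩

/-- The adelic points `X(ℝ) × ∏_p X(ℤ_p)` of the surface `a x² + b y² + c z² = n` over `ℤ`. -/
abbrev AdelicPoints (a b c n : ℤ) : Type :=
  quadricPoints (a : ℝ) (b : ℝ) (c : ℝ) (n : ℝ) ×
    ((p : Nat.Primes) → quadricPoints (a : ℤ_[(p : ℕ)]) (b : ℤ_[(p : ℕ)]) (c : ℤ_[(p : ℕ)])
      (n : ℤ_[(p : ℕ)]))

/-- The coefficient triples of the surfaces in the family of height at most `B`. -/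
def familyUpTo (B : ℝ) : Set (ℤ × ℤ × ℤ) :=
  {t | IsAdmissible t.1 t.2.1 t.2.2 ∧ ((max |t.1| (max |t.2.1| |t.2.2|) : ℤ) : ℝ) ≤ B}

/-- The number of surfaces in the family of height at most `B`. -/
noncomputable def familyCount (B : ℝ) : ℕ := (familyUpTo B).ncard

/-- The number of surfaces in the family of height at most `B` with an adelic point. -/
noncomputable def locCount (n : ℤ) (B : ℝ) : ℕ :=
  {t | t ∈ familyUpTo B ∧ Nonempty (AdelicPoints t.1 t.2.1 t.2.2 n)}.ncard

/-- The real coefficient triples in the cube `[-1, 1]³` that are admissible. -/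
def admissibleCube : Set (ℝ × ℝ × ℝ) :=
  {t | (t.1 ∈ Set.Icc (-1) 1 ∧ t.2.1 ∈ Set.Icc (-1) 1 ∧ t.2.2 ∈ Set.Icc (-1) 1) ∧
    IsAdmissible t.1 t.2.1 t.2.2}

/-- The triples in `admissibleCube` for which the surface has a real point. -/
def realSoluble (n : ℤ) : Set (ℝ × ℝ × ℝ) :=
  {t | t ∈ admissibleCube ∧ (quadricPoints t.1 t.2.1 t.2.2 (n : ℝ)).Nonempty}

/-- The density at the infinite place. -/
noncomputable def sigmaInfty (n : ℤ) : ℝ :=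
  (volume (realSoluble n)).toReal / (volume admissibleCube).toReal

section
variable (p : ℕ) [Fact p.Prime]

noncomputable instance padicIntMeasurableSpace : MeasurableSpace ℤ_[p] := borel ℤ_[p]

instance padicIntBorelSpace : BorelSpace ℤ_[p] := ⟨rfl⟩

/-- The Haar measure on `ℤ_p³` for which the whole space has measure one. -/
noncomputable def haarZp3 : Measure (ℤ_[p] × ℤ_[p] × ℤ_[p]) :=
  Measure.addHaarMeasure ⊤

/-- The coefficient triples in `ℤ_p³` for which the surface has a `ℤ_p`-point. -/
def padicSoluble (n : ℤ) : Set (ℤ_[p] × ℤ_[p] × ℤ_[p]) :=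
  {t | (quadricPoints t.1 t.2.1 t.2.2 (n : ℤ_[p])).Nonempty}

/-- The density at the prime `p`. -/
noncomputable def sigmaPrime (n : ℤ) : ℝ := (haarZp3 p (padicSoluble p n)).toReal

end

/-! For fixed `p`, Hensel's lemma makes solubility over `ℤ_p` depend only on the coefficients modulo
a fixed power of `p` (`mem_padicSoluble_iff`), so `σ_p` is a proportion of residue classes
(`sigmaPrime_eq`). Counting integers of given sign in residue classes, together with the Chinese
remainder theorem, shows that solubility at all `p ≤ M` has density the partial product
(`tendsto_partialLocCount`). The real place imposes nothing, since two coefficients have opposite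
signs.

What remains is a bound for large primes that is uniform in `B`. If `p` is odd, `p ∤ n` and two
coefficients are units at `p`, a solution modulo `p` exists and lifts; so failure at a large `p`
forces `p` to divide two coefficients. At most `24 B³ / p²` triples do this, and summing over `p >
M` gives `O(B³ / M)` (`partialLocCount_le`). Letting `B` and then `M` grow gives the limit. The
explicit formula gives `σ_p = 1 + O(p⁻²)`, so the product converges absolutely; its factors are
positive, so it is non-zero. -/

/-- An exponent `e` such that every `p`-adic integer congruent to `1` modulo `p ^ e` is a square. -/
def squareLevel (p : ℕ) : ℕ := if p = 2 then 3 else 1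

lemma squareLevel_pos (p : ℕ) : 0 < squareLevel p := by
  unfold squareLevel; split_ifs <;> norm_num

/-! ### Hensel's lemma for diagonal quadrics -/

section Padic

variable {p : ℕ} [Fact p.Prime]

lemma PadicInt.norm_two_of_ne_two (hp : p ≠ 2) : ‖(2 : ℤ_[p])‖ = 1 := by
  have h : ‖((2 : ℕ) : ℤ_[p])‖ = 1 := by
    rw [PadicInt.norm_natCast_eq_one_iff]
    exact (Nat.coprime_primes (Fact.out) Nat.prime_two).2 hp
  simpa using h

lemma PadicInt.norm_two_eq_half : ‖(2 : ℤ_[2])‖ = 1 / 2 := by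
  simpa using PadicInt.norm_p (p := 2)

/-- Hensel's lemma for `X² - (1 + s)` at `1`, where the derivative is `2`: it needs `‖s‖ < ‖2‖²`,
which is why the level is `3` at `p = 2` and `1` elsewhere. -/
lemma PadicInt.isSquare_one_add (t : ℤ_[p]) :
    ∃ r : ℤ_[p], r ^ 2 = 1 + (p : ℤ_[p]) ^ squareLevel p * t := by
  set s : ℤ_[p] := (p : ℤ_[p]) ^ squareLevel p * t with hs
  have hs' : ‖s‖ < ‖(2 : ℤ_[p])‖ ^ 2 := by
    have h1 : ‖s‖ ≤ (p : ℝ)⁻¹ ^ squareLevel p := by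
      rw [hs, norm_mul, norm_pow, PadicInt.norm_p]
      exact mul_le_of_le_one_right (by positivity) t.norm_le_one
    refine h1.trans_lt ?_
    by_cases hp : p = 2
    · subst hp
      rw [PadicInt.norm_two_eq_half]
      norm_num [squareLevel]
    · rw [PadicInt.norm_two_of_ne_two hp]
      simp only [squareLevel, hp, if_false, pow_one, one_pow]
      exact inv_lt_one_of_one_lt₀ (by exact_mod_cast (Fact.out : p.Prime).one_lt)
  have := hensels_lemma (p := p) (R := ℤ_[p]) (F := Polynomial.X ^ 2 - Polynomial.C (1 + s))
    (a := 1) (by simpa [one_add_one_eq_two] using hs')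
  obtain ⟨z, hz, -⟩ := this
  exact ⟨z, by simpa [sub_eq_zero] using hz⟩

lemma PadicInt.dvd_pow_of_not_pow_succ_dvd {q : ℤ_[p]} {v : ℕ}
    (h : ¬ (p : ℤ_[p]) ^ (v + 1) ∣ q) : q ∣ (p : ℤ_[p]) ^ v := by
  have hq : q ≠ 0 := by rintro rfl; exact h (dvd_zero _)
  have hspec := PadicInt.unitCoeff_spec hq
  have hle : q.valuation ≤ v := by
    by_contra hlt
    exact h ((pow_dvd_pow _ (by omega)).trans ⟨_, hspec.trans (mul_comm _ _)⟩)
  rw [hspec]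
  exact (Units.mul_left_dvd).2 (pow_dvd_pow _ hle)

/-- If `a * x ^ 2` approximates `m` well compared with its valuation, then `m / a` is a square. -/
lemma PadicInt.exists_mul_sq_eq {a x m : ℤ_[p]} {v : ℕ}
    (hv : ¬ (p : ℤ_[p]) ^ (v + 1) ∣ a * x ^ 2)
    (h : (p : ℤ_[p]) ^ (v + squareLevel p) ∣ m - a * x ^ 2) : ∃ y, a * y ^ 2 = m := by
  obtain ⟨d, hd⟩ := PadicInt.dvd_pow_of_not_pow_succ_dvd hv
  obtain ⟨s, hs⟩ := h
  obtain ⟨r, hr⟩ := PadicInt.isSquare_one_add (d * s)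
  -- With `p ^ v = a x² d`, the error `p ^ v · p ^ e · s` equals `a x² · p ^ e · d s`, so `m = a x²
  -- (1 + p ^ e · d s) = a (x r)²`.
  refine ⟨x * r, ?_⟩
  rw [mul_pow, hr, eq_add_of_sub_eq hs, pow_add, hd]
  ring

/-- If `p ^ (v + 1)` divided all three terms it would divide `n`. So some term has valuation at most
`v`, and adjusting that variable alone absorbs the error. -/
lemma quadricPoints_nonempty_of_dvd {a b c n x y z : ℤ_[p]} {v : ℕ}
    (hv : ¬ (p : ℤ_[p]) ^ (v + 1) ∣ n)
    (h : (p : ℤ_[p]) ^ (v + squareLevel p) ∣ n - (a * x ^ 2 + b * y ^ 2 + c * z ^ 2)) :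
    (quadricPoints a b c n).Nonempty := by
  by_cases hx : (p : ℤ_[p]) ^ (v + 1) ∣ a * x ^ 2
  · by_cases hy : (p : ℤ_[p]) ^ (v + 1) ∣ b * y ^ 2
    · by_cases hz : (p : ℤ_[p]) ^ (v + 1) ∣ c * z ^ 2
      · have h' := (pow_dvd_pow (p : ℤ_[p])
          (Nat.add_le_add_left (squareLevel_pos p) v)).trans h
        exact absurd ((dvd_sub_left (dvd_add (dvd_add hx hy) hz)).1 h') hv
      · obtain ⟨w, hw⟩ := PadicInt.exists_mul_sq_eq (m := n - a * x ^ 2 - b * y ^ 2) hz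
          (by convert h using 1; ring)
        exact ⟨(x, y, w), by simp only [quadricPoints, Set.mem_ofPred_eq, hw]; ring⟩
    · obtain ⟨w, hw⟩ := PadicInt.exists_mul_sq_eq (m := n - a * x ^ 2 - c * z ^ 2) hy
        (by convert h using 1; ring)
      exact ⟨(x, w, z), by simp only [quadricPoints, Set.mem_ofPred_eq, hw]; ring⟩
  · obtain ⟨w, hw⟩ := PadicInt.exists_mul_sq_eq (m := n - b * y ^ 2 - c * z ^ 2) hx
      (by convert h using 1; ring)
    exact ⟨(w, y, z), by simp only [quadricPoints, Set.mem_ofPred_eq, hw]; ring⟩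

end Padic

lemma quadricPoints_nonempty_map {R S : Type*} [CommRing R] [CommRing S] (f : R →+* S)
    {a b c n : R} (h : (quadricPoints a b c n).Nonempty) :
    (quadricPoints (f a) (f b) (f c) (f n)).Nonempty := by
  obtain ⟨v, hv⟩ := h
  refine ⟨(f v.1, f v.2.1, f v.2.2), ?_⟩
  simp only [quadricPoints, Set.mem_ofPred_eq] at hv ⊢
  rw [← hv]; simp

/-! ### Local solubility as a congruence condition -/

/-- The coefficient triples modulo `m` for which the equation is soluble modulo `m`. -/
def solubleMod (m : ℕ) (n : ℤ) : Set (ZMod m × ZMod m × ZMod m) :=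
  {t | (quadricPoints t.1 t.2.1 t.2.2 (n : ZMod m)).Nonempty}

section Reduction

variable (p : ℕ) [Fact p.Prime]

/-- Reduction of coefficient triples modulo `p ^ k`. -/
noncomputable def padicReduction (k : ℕ) :
    ℤ_[p] × ℤ_[p] × ℤ_[p] →+ ZMod (p ^ k) × ZMod (p ^ k) × ZMod (p ^ k) :=
  let f := (PadicInt.toZModPow (p := p) k).toAddMonoidHom
  f.prodMap (f.prodMap f)

lemma padicReduction_apply (k : ℕ) (t : ℤ_[p] × ℤ_[p] × ℤ_[p]) :
    padicReduction p k t = (PadicInt.toZModPow k t.1, PadicInt.toZModPow k t.2.1,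
      PadicInt.toZModPow k t.2.2) := rfl

lemma toZModPow_surjective (k : ℕ) : Function.Surjective (PadicInt.toZModPow (p := p) k) :=
  ZMod.ringHom_surjective _

lemma padicReduction_surjective (k : ℕ) : Function.Surjective (padicReduction p k) := by
  rintro ⟨a, b, c⟩
  obtain ⟨a, rfl⟩ := toZModPow_surjective p k a
  obtain ⟨b, rfl⟩ := toZModPow_surjective p k b
  obtain ⟨c, rfl⟩ := toZModPow_surjective p k c
  exact ⟨(a, b, c), rfl⟩

-- One direction is reduction; for the other, any lift of a solution modulo `p ^ (v + squareLevel
-- p)` is close enough for Hensel's lemma.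
variable {p} in
lemma mem_padicSoluble_iff {n : ℤ} {v : ℕ} (hv : ¬ (p : ℤ) ^ (v + 1) ∣ n)
    (t : ℤ_[p] × ℤ_[p] × ℤ_[p]) :
    t ∈ padicSoluble p n ↔
      padicReduction p (v + squareLevel p) t ∈ solubleMod (p ^ (v + squareLevel p)) n := by
  rw [padicReduction_apply]
  refine ⟨fun h => ?_, ?_⟩
  · have := quadricPoints_nonempty_map (PadicInt.toZModPow (p := p) (v + squareLevel p)) h
    rwa [map_intCast] at this
  · rintro ⟨⟨x, y, z⟩, h⟩
    obtain ⟨x, rfl⟩ := toZModPow_surjective p _ x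
    obtain ⟨y, rfl⟩ := toZModPow_surjective p _ y
    obtain ⟨z, rfl⟩ := toZModPow_surjective p _ z
    refine quadricPoints_nonempty_of_dvd (x := x) (y := y) (z := z) (v := v) ?_ ?_
    · rw [PadicInt.pow_p_dvd_int_iff]
      exact_mod_cast hv
    · rw [← Ideal.mem_span_singleton, ← PadicInt.ker_toZModPow, RingHom.mem_ker]
      simp only [quadricPoints, Set.mem_ofPred_eq] at h
      simp [h]

lemma isOpen_preimage_toZModPow (k : ℕ) (s : Set (ZMod (p ^ k))) :
    IsOpen (PadicInt.toZModPow (p := p) k ⁻¹' s) := by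
  rw [Metric.isOpen_iff]
  intro x hx
  -- The norm takes discrete values: being at most `p ^ (-k)` is the same as being less than `p ^ (1
  -- - k)`.
  refine ⟨(p : ℝ) ^ (1 - (k : ℤ)), zpow_pos (by exact_mod_cast (Fact.out : p.Prime).pos) _, ?_⟩
  intro y hy
  rw [Metric.mem_ball, dist_eq_norm] at hy
  have : y - x ∈ RingHom.ker (PadicInt.toZModPow (p := p) k) := by
    rw [PadicInt.ker_toZModPow, ← PadicInt.norm_le_pow_iff_mem_span_pow,
      PadicInt.norm_le_pow_iff_norm_lt_pow_add_one]
    convert hy using 2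
    ring
  rw [RingHom.mem_ker, map_sub, sub_eq_zero] at this
  rwa [Set.mem_preimage, this]

lemma isOpen_preimage_padicReduction (k : ℕ) (s : Set (ZMod (p ^ k) × ZMod (p ^ k) × ZMod (p ^ k))) :
    IsOpen (padicReduction p k ⁻¹' s) := by
  rw [← Set.biUnion_of_singleton s, Set.preimage_iUnion₂]
  refine isOpen_biUnion fun t _ => ?_
  have : padicReduction p k ⁻¹' {t} = (PadicInt.toZModPow (p := p) k ⁻¹' {t.1}) ×ˢ
      ((PadicInt.toZModPow (p := p) k ⁻¹' {t.2.1}) ×ˢ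
        (PadicInt.toZModPow (p := p) k ⁻¹' {t.2.2})) := by
    ext x
    simp [padicReduction_apply, Prod.ext_iff]
  rw [this]
  exact (isOpen_preimage_toZModPow p k _).prod
    ((isOpen_preimage_toZModPow p k _).prod (isOpen_preimage_toZModPow p k _))

end Reduction

/-! ### Local densities as proportions of residue classes -/

/-- A translation invariant probability measure pushes forward to the counting density under a
surjection onto a finite group. -/
lemma measure_preimage_of_surjective {G H : Type*} [AddGroup G] [MeasurableSpace G]
    [MeasurableAdd G] (μ : Measure G) [IsProbabilityMeasure μ] [μ.IsAddLeftInvariant]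
    [AddGroup H] [Finite H] (f : G →+ H) (hf : Function.Surjective f)
    (hm : ∀ s, MeasurableSet (f ⁻¹' s)) (s : Set H) :
    (μ (f ⁻¹' s)).toReal = s.ncard / Nat.card H := by
  classical
  have := Fintype.ofFinite H
  -- The fibres are translates of one another, so they have equal measure.
  have hfib : ∀ h, μ.real (f ⁻¹' {h}) = μ.real (f ⁻¹' {0}) := by
    intro h
    obtain ⟨g, rfl⟩ := hf h
    have : f ⁻¹' {0} = (fun x => g + x) ⁻¹' (f ⁻¹' {f g}) := by
      ext x; simp
    rw [this, Measure.real, Measure.real, measure_preimage_add]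
  have key : ∀ s : Finset H, μ.real (f ⁻¹' s) = s.card * μ.real (f ⁻¹' {0}) := by
    intro s
    have : f ⁻¹' (s : Set H) = ⋃ h ∈ s, f ⁻¹' {h} := by
      ext x; simp
    rw [this, measureReal_biUnion_finset _ fun h _ => hm _]
    · simp [hfib]
    · intro a _ b _ hab
      exact Disjoint.preimage _ (by simpa using hab)
  have h1 : (Nat.card H : ℝ) * μ.real (f ⁻¹' {0}) = 1 := by
    have := key Finset.univ
    rw [Finset.coe_univ, Set.preimage_univ, probReal_univ] at this
    rw [this, Nat.card_eq_fintype_card, Finset.card_univ]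
  have h0 : (Nat.card H : ℝ) ≠ 0 := left_ne_zero_of_mul_eq_one h1
  have hs := key s.toFinset
  rw [Set.coe_toFinset] at hs
  rw [← Measure.real, hs, Set.ncard_eq_toFinset_card', eq_div_iff h0, mul_assoc, mul_comm _ (Nat.card H : ℝ),
    h1, mul_one]

instance haarZp3_isProbabilityMeasure (p : ℕ) [Fact p.Prime] :
    IsProbabilityMeasure (haarZp3 p) :=
  ⟨by simpa [haarZp3] using Measure.addHaarMeasure_self
        (K₀ := (⊤ : TopologicalSpace.PositiveCompacts (ℤ_[p] × ℤ_[p] × ℤ_[p])))⟩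

instance haarZp3_isAddLeftInvariant (p : ℕ) [Fact p.Prime] :
    (haarZp3 p).IsAddLeftInvariant := by
  unfold haarZp3; infer_instance

lemma sigmaPrime_eq (p : ℕ) [Fact p.Prime] {n : ℤ} {v : ℕ} (hv : ¬ (p : ℤ) ^ (v + 1) ∣ n) :
    sigmaPrime p n = (solubleMod (p ^ (v + squareLevel p)) n).ncard /
      ((p : ℝ) ^ (v + squareLevel p)) ^ 3 := by
  have : padicSoluble p n = padicReduction p (v + squareLevel p) ⁻¹'
      solubleMod (p ^ (v + squareLevel p)) n := by
    ext t; exact mem_padicSoluble_iff hv t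
  have _ : NeZero (p ^ (v + squareLevel p)) := ⟨pow_ne_zero _ (Fact.out : p.Prime).ne_zero⟩
  rw [sigmaPrime, this, measure_preimage_of_surjective (haarZp3 p) (padicReduction p _)
    (padicReduction_surjective p _)
    (fun s => (isOpen_preimage_padicReduction p _ s).measurableSet)]
  simp only [Nat.card_prod, Nat.card_zmod]
  push_cast
  ring

/-! ### The density at odd primes not dividing `n` -/

lemma quadricPoints_perm {R : Type*} [CommRing R] (a b c n : R) :
    (quadricPoints a b c n).Nonempty ↔ (quadricPoints b c a n).Nonempty := by
  constructor
  · rintro ⟨⟨x, y, z⟩, h⟩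
    exact ⟨(y, z, x), by simp only [quadricPoints, Set.mem_ofPred_eq] at h ⊢; rw [← h]; ring⟩
  · rintro ⟨⟨y, z, x⟩, h⟩
    exact ⟨(x, y, z), by simp only [quadricPoints, Set.mem_ofPred_eq] at h ⊢; rw [← h]; ring⟩

/-- Pigeonhole: `a x²` and `n - b y²` each take `(p + 1) / 2` values, so they share one. The third
variable is set to `0`. -/
lemma quadricPoints_nonempty_of_ne_zero {p : ℕ} [Fact p.Prime] (hp : p ≠ 2) {a b : ZMod p}
    (ha : a ≠ 0) (hb : b ≠ 0) (c n : ZMod p) : (quadricPoints a b c n).Nonempty := by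
  have hodd : Fintype.card (ZMod p) % 2 = 1 := by
    rw [ZMod.card]; exact (Nat.Prime.eq_two_or_odd Fact.out).resolve_left hp
  obtain ⟨x, y, h⟩ := FiniteField.exists_root_sum_quadratic
    (f := Polynomial.C a * Polynomial.X ^ 2)
    (g := Polynomial.C b * Polynomial.X ^ 2 + Polynomial.C 0 * Polynomial.X + Polynomial.C (-n))
    (by simpa using Polynomial.degree_C_mul_X_pow 2 ha) (Polynomial.degree_quadratic hb) hodd
  refine ⟨(x, y, 0), ?_⟩
  simp only [Polynomial.eval_mul, Polynomial.eval_C, Polynomial.eval_pow, Polynomial.eval_X,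
    Polynomial.eval_add] at h
  simp only [quadricPoints, Set.mem_ofPred_eq]
  linear_combination h

lemma quadricPoints_zero_zero_nonempty_iff {F : Type*} [Field F] {n : F} (hn : n ≠ 0) (a : F) :
    (quadricPoints a 0 0 n).Nonempty ↔ a ≠ 0 ∧ IsSquare (a * n) := by
  constructor
  · rintro ⟨⟨x, y, z⟩, h⟩
    simp only [quadricPoints, Set.mem_ofPred_eq, zero_mul, add_zero] at h
    refine ⟨fun h0 => hn (by rw [← h, h0, zero_mul]), a * x, by rw [← h]; ring⟩
  · rintro ⟨ha, r, hr⟩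
    refine ⟨(r / a, 0, 0), ?_⟩
    simp only [quadricPoints, Set.mem_ofPred_eq, zero_mul, add_zero]
    field_simp
    linear_combination -hr

lemma card_quadraticChar_eq_neg_one (p : ℕ) [Fact p.Prime] (hp : p ≠ 2) :
    2 * (Finset.univ.filter fun a : ZMod p => quadraticChar (ZMod p) a = -1).card + 1 = p := by
  have hsum := quadraticChar_sum_zero (F := ZMod p) (by rwa [ZMod.ringChar_zmod_n])
  -- Expressing the character by indicators turns the vanishing of its sum into a count of
  -- non-squares.
  have h1 : ∀ a : ZMod p, quadraticChar (ZMod p) a =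
      1 - (if a = 0 then 1 else 0) - 2 * (if quadraticChar (ZMod p) a = -1 then 1 else 0) := by
    intro a
    by_cases ha : a = 0
    · subst ha; simp
    · rcases quadraticChar_dichotomy ha with h | h <;> simp [h, ha]
  rw [Finset.sum_congr rfl fun a _ => h1 a] at hsum
  simp only [Finset.sum_sub_distrib, ← Finset.mul_sum, Finset.sum_boole] at hsum
  simp only [Finset.sum_const, Finset.card_univ, ZMod.card, Finset.filter_eq', Finset.mem_univ,
    if_true, Finset.card_singleton, nsmul_eq_mul, mul_one, Nat.cast_one] at hsum
  have : ((2 * (Finset.univ.filter fun a : ZMod p => quadraticChar (ZMod p) a = -1).card + 1 : ℕ) : ℤ)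
      = p := by push_cast; linarith
  exact_mod_cast this

lemma card_not_isSquare_mul (p : ℕ) [Fact p.Prime] (hp : p ≠ 2) {n : ZMod p} (hn : n ≠ 0) :
    2 * ({a : ZMod p | ¬ IsSquare (a * n)}).ncard + 1 = p := by
  refine Eq.trans ?_ (card_quadraticChar_eq_neg_one p hp)
  rw [← Set.ncard_coe_finset]
  congr 2
  rw [← Set.ncard_image_of_injective _ (mul_left_injective₀ hn)]
  congr 1
  ext b
  simp only [Set.mem_image, Set.mem_ofPred_eq, Finset.coe_filter, Finset.mem_univ, true_and,
    quadraticChar_neg_one_iff_not_isSquare]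
  exact ⟨by rintro ⟨a, ha, rfl⟩; exact ha, fun hb => ⟨b * n⁻¹, by simpa [hn] using hb, by simp [hn]⟩⟩

/-- Insolubility requires two vanishing coefficients. Since `0` is a square, the zero triple lies in
none of the three axes' sets and is listed apart, making the union disjoint. -/
lemma compl_solubleMod_prime (p : ℕ) [Fact p.Prime] (hp : p ≠ 2) {n : ℤ} (hn : (n : ZMod p) ≠ 0) :
    (solubleMod p n)ᶜ = ((((fun a => (a, 0, 0)) '' {a : ZMod p | ¬ IsSquare (a * n)}) ∪
      ((fun a => (0, a, 0)) '' {a : ZMod p | ¬ IsSquare (a * n)})) ∪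
      ((fun a => (0, 0, a)) '' {a : ZMod p | ¬ IsSquare (a * n)})) ∪ {0} := by
  have key := fun a => quadricPoints_zero_zero_nonempty_iff hn a
  ext ⟨a, b, c⟩
  simp only [solubleMod, Set.mem_compl_iff, Set.mem_ofPred_eq, Set.mem_union, Set.mem_image,
    Prod.mk.injEq, Set.mem_singleton_iff, Prod.mk_eq_zero]
  by_cases ha : a = 0
  · by_cases hb : b = 0
    · subst ha hb
      rw [← quadricPoints_perm, key]
      by_cases hc : c = 0
      · subst hc; simp
      · simp [hc]
    · by_cases hc : c = 0
      · subst ha hc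
        rw [quadricPoints_perm, key]
        simp [hb]
      · have := quadricPoints_nonempty_of_ne_zero hp hb hc a (n : ZMod p)
        rw [← quadricPoints_perm] at this
        subst ha
        simp [this, hb, hc, Ne.symm hb, Ne.symm hc]
  · by_cases hb : b = 0
    · by_cases hc : c = 0
      · subst hb hc
        rw [key]
        simp [ha]
      · have := quadricPoints_nonempty_of_ne_zero hp hc ha b (n : ZMod p)
        rw [quadricPoints_perm] at this
        subst hb
        simp [this, ha, hc, Ne.symm ha, Ne.symm hc]
    · have := quadricPoints_nonempty_of_ne_zero hp ha hb c (n : ZMod p)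
      simp [this, ha, hb, Ne.symm ha, Ne.symm hb]

lemma ncard_solubleMod_prime (p : ℕ) [Fact p.Prime] (hp : p ≠ 2) {n : ℤ}
    (hn : (n : ZMod p) ≠ 0) :
    ((solubleMod p n).ncard : ℝ) = (p : ℝ) ^ 3 - 3 * (((p : ℝ) - 1) / 2) - 1 := by
  have hU : ∀ a : ZMod p, ¬ IsSquare (a * n) → a ≠ 0 := by
    rintro a ha rfl; exact ha (by simp)
  have hcard := card_not_isSquare_mul p hp hn
  have hc : (solubleMod p n)ᶜ.ncard = 3 * {a : ZMod p | ¬ IsSquare (a * n)}.ncard + 1 := by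
    rw [compl_solubleMod_prime p hp hn, Set.ncard_union_eq, Set.ncard_union_eq, Set.ncard_union_eq,
      Set.ncard_image_of_injective, Set.ncard_image_of_injective, Set.ncard_image_of_injective,
      Set.ncard_singleton]
    · ring
    · intro a b h; simpa using h
    · intro a b h; simpa using h
    · intro a b h; simpa using h
    · rw [Set.disjoint_left]
      rintro _ ⟨a, ha, rfl⟩ ⟨b, hb, h⟩
      simp only [Prod.mk.injEq] at h
      exact hU a ha h.1.symm
    · rw [Set.disjoint_left]
      rintro _ (⟨a, ha, rfl⟩ | ⟨a, ha, rfl⟩) ⟨b, hb, h⟩ <;> simp only [Prod.mk.injEq] at h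
      · exact hU a ha h.1.symm
      · exact hU a ha h.2.1.symm
    · rw [Set.disjoint_right]
      rintro _ rfl ((⟨a, ha, h⟩ | ⟨a, ha, h⟩) | ⟨a, ha, h⟩) <;>
        simp only [Prod.mk_eq_zero] at h <;> exact hU a ha (by tauto)
  have h1 := Set.ncard_add_ncard_compl (solubleMod p n)
  rw [hc] at h1
  simp only [Nat.card_prod, Nat.card_zmod] at h1
  have h1' : ((solubleMod p n).ncard : ℝ) + (3 * {a : ZMod p | ¬ IsSquare (a * n)}.ncard + 1) =
      p * (p * p) := by exact_mod_cast h1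
  have h2' : (2 * {a : ZMod p | ¬ IsSquare (a * n)}.ncard + 1 : ℝ) = p := by exact_mod_cast hcard
  linear_combination h1' - 3 / 2 * h2'

lemma sigmaPrime_eq_of_odd_prime (p : ℕ) [Fact p.Prime] (hp : p ≠ 2) {n : ℤ} (hn : ¬ (p : ℤ) ∣ n) :
    sigmaPrime p n = 1 - 3 / 2 * (p : ℝ)⁻¹ ^ 2 + 1 / 2 * (p : ℝ)⁻¹ ^ 3 := by
  have h := sigmaPrime_eq p (v := 0) (n := n) (by simpa using hn)
  have hs : 0 + squareLevel p = 1 := by simp [squareLevel, hp]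
  have hpos : (p : ℝ) ≠ 0 := by exact_mod_cast (Fact.out : p.Prime).ne_zero
  rw [hs, pow_one, pow_one] at h
  rw [h, ncard_solubleMod_prime p hp (by rwa [Ne, ZMod.intCast_zmod_eq_zero_iff_dvd])]
  field_simp
  ring

/-! ### The density at `2` for odd `n` -/

lemma ncard_solubleMod_eight_one : (solubleMod 8 1).ncard = 357 := by
  -- The squares modulo `8` are `0, 1, 4`, so 27 choices per triple suffice, in natural number
  -- arithmetic that the kernel evaluates quickly.
  have hset : solubleMod 8 1 = ((Finset.univ.filter fun t : ZMod 8 × ZMod 8 × ZMod 8 =>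
      ([0, 1, 4].any fun x => [0, 1, 4].any fun y => [0, 1, 4].any fun z =>
        (t.1.val * x + t.2.1.val * y + t.2.2.val * z) % 8 == 1) = true :
        Finset (ZMod 8 × ZMod 8 × ZMod 8)) : Set (ZMod 8 × ZMod 8 × ZMod 8)) := by
    have hsq : ∀ x : ZMod 8, ∃ k ∈ [0, 1, 4], x ^ 2 = ((k : ℕ) : ZMod 8) := by decide
    have hroot : ∀ k ∈ [0, 1, 4], ∃ x : ZMod 8, x ^ 2 = ((k : ℕ) : ZMod 8) := by decide
    have hval : ∀ (a b c : ZMod 8) (x y z : ℕ),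
        (a.val * x + b.val * y + c.val * z) % 8 = 1 ↔ a * x + b * y + c * z = 1 := by
      intro a b c x y z
      have := ZMod.natCast_eq_natCast_iff' (a.val * x + b.val * y + c.val * z) 1 8
      push_cast [ZMod.natCast_zmod_val] at this
      exact this.symm
    ext ⟨a, b, c⟩
    simp only [solubleMod, quadricPoints, Set.mem_ofPred_eq, Finset.coe_filter, Finset.mem_univ,
      true_and, List.any_eq_true, beq_iff_eq, hval, Int.cast_one]
    constructor
    · rintro ⟨⟨x, y, z⟩, h⟩
      obtain ⟨i, hi, hx⟩ := hsq x
      obtain ⟨j, hj, hy⟩ := hsq y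
      obtain ⟨k, hk, hz⟩ := hsq z
      refine ⟨i, hi, j, hj, k, hk, ?_⟩
      rw [← hx, ← hy, ← hz]
      exact h
    · rintro ⟨i, hi, j, hj, k, hk, h⟩
      obtain ⟨x, hx⟩ := hroot i hi
      obtain ⟨y, hy⟩ := hroot j hj
      obtain ⟨z, hz⟩ := hroot k hk
      rw [← hx, ← hy, ← hz] at h
      exact ⟨(x, y, z), h⟩
  rw [hset]
  refine (Set.ncard_coe_finset _).trans ?_
  decide +kernel

/-- As `n² = 1` modulo `8`, scaling the coefficients by `n` is an involution that exchanges the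
right-hand sides `n` and `1`. -/
lemma ncard_solubleMod_eight {n : ℤ} (hn : Odd n) : (solubleMod 8 n).ncard = 357 := by
  have hsq : (n : ZMod 8) * n = 1 := by
    obtain ⟨m, rfl⟩ := hn
    push_cast
    generalize (m : ZMod 8) = x
    revert x
    decide
  have hmul : ∀ x : ZMod 8, (n : ZMod 8) * (n * x) = x := fun x => by
    rw [← mul_assoc, hsq, one_mul]
  rw [← ncard_solubleMod_eight_one, ← Set.ncard_image_of_injective (solubleMod 8 n)
    (f := fun t => ((n : ZMod 8) * t.1, (n : ZMod 8) * t.2.1, (n : ZMod 8) * t.2.2))]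
  · congr 1
    ext ⟨a, b, c⟩
    simp only [solubleMod, quadricPoints, Set.mem_image, Set.mem_ofPred_eq, Int.cast_one]
    constructor
    · rintro ⟨⟨a, b, c⟩, ⟨⟨x, y, z⟩, h⟩, h'⟩
      simp only [Prod.mk.injEq] at h'
      obtain ⟨rfl, rfl, rfl⟩ := h'
      refine ⟨(x, y, z), ?_⟩
      simp only [Set.mem_ofPred_eq] at h ⊢
      linear_combination (n : ZMod 8) * h + hsq
    · rintro ⟨⟨x, y, z⟩, h⟩
      refine ⟨(n * a, n * b, n * c), ⟨(x, y, z), ?_⟩, by simp only [hmul]⟩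
      simp only [Set.mem_ofPred_eq] at h ⊢
      linear_combination (n : ZMod 8) * h
  · rintro ⟨a, b, c⟩ ⟨a', b', c'⟩ h
    simp only [Prod.mk.injEq] at h
    rw [← hmul a, ← hmul b, ← hmul c, h.1, h.2.1, h.2.2, hmul, hmul, hmul]

lemma sigmaPrime_two_of_odd {n : ℤ} (hn : Odd n) : sigmaPrime 2 n = 357 / 512 := by
  have h := sigmaPrime_eq 2 (v := 0) (n := n) (by
    simpa [← even_iff_two_dvd] using hn)
  have hcard : (solubleMod (2 ^ (0 + squareLevel 2)) n).ncard = 357 := ncard_solubleMod_eight hn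
  rw [h, hcard]
  norm_num [squareLevel]

lemma sigmaPrime_pos (p : ℕ) [Fact p.Prime] {n : ℤ} {v : ℕ} (hv : ¬ (p : ℤ) ^ (v + 1) ∣ n) :
    0 < sigmaPrime p n := by
  have _ : NeZero (p ^ (v + squareLevel p)) := ⟨pow_ne_zero _ (Fact.out : p.Prime).ne_zero⟩
  rw [sigmaPrime_eq p hv]
  have : 0 < (solubleMod (p ^ (v + squareLevel p)) n).ncard := by
    rw [Set.ncard_pos]
    -- The equation `n x² = n` has the solution `x = 1`.
    exact ⟨(n, 0, 0), (1, 0, 0), by simp [quadricPoints]⟩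
  have hp : (0 : ℝ) < p := by exact_mod_cast (Fact.out : p.Prime).pos
  positivity

/-! ### The real place -/

lemma quadricPoints_nonempty_of_pos_of_neg {a b : ℝ} (ha : 0 < a) (hb : b < 0) (c n : ℝ) :
    (quadricPoints a b c n).Nonempty := by
  rcases le_total 0 n with hn | hn
  · refine ⟨(√(n / a), 0, 0), ?_⟩
    simp only [quadricPoints, Set.mem_ofPred_eq]
    rw [Real.sq_sqrt (by positivity)]
    field_simp
    ring
  · refine ⟨(0, √(n / b), 0), ?_⟩
    simp only [quadricPoints, Set.mem_ofPred_eq]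
    rw [Real.sq_sqrt (div_nonneg_of_nonpos hn hb.le), mul_div_cancel₀ _ hb.ne]
    ring

lemma IsAdmissible.quadricPoints_nonempty {a b c : ℝ} (h : IsAdmissible a b c) (n : ℝ) :
    (quadricPoints a b c n).Nonempty := by
  obtain ⟨⟨ha, hb, hc⟩, h1, h2⟩ := h
  have swap : ∀ a b c : ℝ, (quadricPoints a b c n).Nonempty → (quadricPoints b a c n).Nonempty := by
    rintro a b c ⟨⟨x, y, z⟩, h⟩
    exact ⟨(y, x, z), by simp only [quadricPoints, Set.mem_ofPred_eq] at h ⊢; rw [← h]; ring⟩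
  rcases lt_or_gt_of_ne ha with ha | ha <;> rcases lt_or_gt_of_ne hb with hb | hb <;>
    rcases lt_or_gt_of_ne hc with hc | hc
  · exact absurd ⟨ha, hb, hc⟩ h2
  · rw [← quadricPoints_perm]; exact quadricPoints_nonempty_of_pos_of_neg hc ha _ _
  · exact swap _ _ _ (quadricPoints_nonempty_of_pos_of_neg hb ha _ _)
  · exact swap _ _ _ (quadricPoints_nonempty_of_pos_of_neg hb ha _ _)
  · exact quadricPoints_nonempty_of_pos_of_neg ha hb _ _
  · exact quadricPoints_nonempty_of_pos_of_neg ha hb _ _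
  · rw [quadricPoints_perm]; exact quadricPoints_nonempty_of_pos_of_neg hb hc _ _
  · exact absurd ⟨ha, hb, hc⟩ h1

lemma realSoluble_eq (n : ℤ) : realSoluble n = admissibleCube := by
  ext t
  exact ⟨fun h => h.1, fun h => ⟨h, h.2.quadricPoints_nonempty _⟩⟩

lemma volume_admissibleCube : (volume admissibleCube).toReal = 6 := by
  let P : Set ℝ := Set.Ioc 0 1
  let N : Set ℝ := Set.Ico (-1) 0
  have hPN : Disjoint P N := by
    rw [Set.disjoint_left]; rintro x ⟨h, -⟩ ⟨-, h'⟩; exact lt_asymm h h'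
  have hvP : volume P = 1 := by simp [P]
  have hvN : volume N = 1 := by simp [N]
  have hmP : MeasurableSet P := measurableSet_Ioc
  have hmN : MeasurableSet N := measurableSet_Ico
  have hvU : volume (P ∪ N) = 2 := by
    rw [measure_union hPN hmN, hvP, hvN, one_add_one_eq_two]
  have hsign : ∀ x : ℝ, (x ∈ Set.Icc (-1) 1 ∧ x ≠ 0) ↔ x ∈ P ∪ N := by
    intro x
    simp only [Set.mem_Icc, Set.mem_union, P, N, Set.mem_Ioc, Set.mem_Ico]
    constructor
    · rintro ⟨⟨h1, h2⟩, h3⟩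
      rcases lt_or_gt_of_ne h3 with h | h
      · exact Or.inr ⟨h1, h⟩
      · exact Or.inl ⟨h, h2⟩
    · rintro (⟨h1, h2⟩ | ⟨h1, h2⟩)
      · exact ⟨⟨by linarith, h2⟩, h1.ne'⟩
      · exact ⟨⟨h1, by linarith⟩, h2.ne⟩
  -- Off the coordinate planes the cube has volume `8`; the two octants of constant sign have volume
  -- `1` each.
  have hset : admissibleCube =
      ((P ∪ N) ×ˢ (P ∪ N) ×ˢ (P ∪ N)) \ (P ×ˢ P ×ˢ P ∪ N ×ˢ N ×ˢ N) := by
    ext ⟨a, b, c⟩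
    simp only [Set.mem_sdiff, Set.mem_prod, ← hsign, admissibleCube, IsAdmissible,
      Set.mem_ofPred_eq, Set.mem_union, P, N, Set.mem_Ioc, Set.mem_Ico, Set.mem_Icc]
    tauto
  have hcube : ∀ s : Set ℝ, volume (s ×ˢ s ×ˢ s) = volume s * (volume s * volume s) := by
    intro s
    rw [Measure.volume_eq_prod, Measure.prod_prod, Measure.volume_eq_prod, Measure.prod_prod]
  have hsub : P ×ˢ P ×ˢ P ∪ N ×ˢ N ×ˢ N ⊆ (P ∪ N) ×ˢ (P ∪ N) ×ˢ (P ∪ N) := by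
    have h1 : P ⊆ P ∪ N := Set.subset_union_left
    have h2 : N ⊆ P ∪ N := Set.subset_union_right
    exact Set.union_subset (Set.prod_mono h1 (Set.prod_mono h1 h1))
      (Set.prod_mono h2 (Set.prod_mono h2 h2))
  have hm : MeasurableSet (P ×ˢ P ×ˢ P ∪ N ×ˢ N ×ˢ N) :=
    (hmP.prod (hmP.prod hmP)).union (hmN.prod (hmN.prod hmN))
  have hv : volume (P ×ˢ P ×ˢ P ∪ N ×ˢ N ×ˢ N) = 2 := by
    rw [measure_union (Set.Disjoint.set_prod_left hPN _ _) (hmN.prod (hmN.prod hmN)), hcube,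
      hcube, hvP, hvN]
    norm_num
  rw [hset, measure_sdiff hsub hm.nullMeasurableSet (by rw [hv]; simp), hv, hcube, hvU,
    ENNReal.toReal_sub_of_le (by norm_num) (by finiteness)]
  norm_num

lemma sigmaInfty_eq_one (n : ℤ) : sigmaInfty n = 1 := by
  rw [sigmaInfty, realSoluble_eq, volume_admissibleCube]
  norm_num

/-! ### Counting coefficient triples in residue classes -/

/-- The non-zero integers of absolute value at most `B`, of the sign given by `s`, in the residue
class `r`. -/
noncomputable def signedResidues (Q : ℕ) (s : Bool) (r : ZMod Q) (B : ℝ) : Finset ℤ :=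
  (Finset.Icc (-⌊B⌋) ⌊B⌋).filter fun x => x ≠ 0 ∧ decide (0 < x) = s ∧ (x : ZMod Q) = r

lemma mem_signedResidues {Q : ℕ} {s : Bool} {r : ZMod Q} {B : ℝ} {x : ℤ} :
    x ∈ signedResidues Q s r B ↔
      |x| ≤ ⌊B⌋ ∧ x ≠ 0 ∧ decide (0 < x) = s ∧ (x : ZMod Q) = r := by
  simp [signedResidues, abs_le, and_assoc]

/-- Replacing `B` by its floor costs at most `1`, and the difference of two roundings costs at most
`1` more. -/
lemma abs_card_signedResidues_sub_le (Q : ℕ) [NeZero Q] (s : Bool) (r : ZMod Q) {B : ℝ}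
    (hB : 0 ≤ B) : |((signedResidues Q s r B).card : ℝ) - B / Q| ≤ 2 := by
  obtain ⟨v, rfl⟩ := ZMod.intCast_surjective r
  have hQ : 0 < (Q : ℤ) := by exact_mod_cast NeZero.pos Q
  have hQ1 : (1 : ℝ) ≤ Q := by exact_mod_cast NeZero.one_le
  have hN : 0 ≤ ⌊B⌋ := Int.floor_nonneg.2 hB
  have hN1 := Int.floor_le B
  have hN2 := Int.lt_floor_add_one B
  have hd1 : (⌊B⌋ : ℝ) / Q ≤ B / Q := by gcongr
  have hd2 : B / Q ≤ ⌊B⌋ / Q + 1 := by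
    rw [div_add_one (by positivity)]
    gcongr
    linarith
  have hmod : ∀ x : ℤ, ((x : ZMod Q) = (v : ZMod Q)) ↔ x ≡ v [ZMOD Q] := fun x =>
    ZMod.intCast_eq_intCast_iff x v Q
  cases s
  · have hs : signedResidues Q false (v : ZMod Q) B =
        (Finset.Ico (-⌊B⌋) 0).filter (· ≡ v [ZMOD Q]) := by
      ext x
      simp only [mem_signedResidues, Finset.mem_filter, Finset.mem_Ico, hmod, abs_le,
        decide_eq_false_iff_not]
      constructor
      · rintro ⟨h1, h2, h3, h4⟩; exact ⟨⟨h1.1, by omega⟩, h4⟩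
      · rintro ⟨h1, h4⟩; exact ⟨⟨h1.1, by omega⟩, by omega, by omega, h4⟩
    have hc := Int.Ico_filter_modEq_card (-⌊B⌋) 0 hQ v
    rw [max_eq_left] at hc
    · rw [hs]
      have hc' : (((Finset.Ico (-⌊B⌋) 0).filter (· ≡ v [ZMOD Q])).card : ℝ) =
          (⌈(((0 : ℤ) - v : ℤ) : ℚ) / ((Q : ℤ) : ℚ)⌉ : ℝ) -
          (⌈((-⌊B⌋ - v : ℤ) : ℚ) / ((Q : ℤ) : ℚ)⌉ : ℝ) := by
        have := congrArg (Int.cast : ℤ → ℝ) hc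
        push_cast at this ⊢
        exact this
      rw [hc']
      have e1 : (⌈(((0 : ℤ) - v : ℤ) : ℚ) / ((Q : ℤ) : ℚ)⌉) = ⌈(-v : ℝ) / Q⌉ := by
        rw [← Rat.ceil_cast (α := ℝ)]; push_cast; simp
      have e2 : (⌈((-⌊B⌋ - v : ℤ) : ℚ) / ((Q : ℤ) : ℚ)⌉) = ⌈(-⌊B⌋ - v : ℝ) / Q⌉ := by
        rw [← Rat.ceil_cast (α := ℝ)]; push_cast; simp
      rw [e1, e2]
      have a1 := Int.le_ceil ((-v : ℝ) / Q)
      have a2 := Int.ceil_lt_add_one ((-v : ℝ) / Q)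
      have a3 := Int.le_ceil ((-⌊B⌋ - v : ℝ) / Q)
      have a4 := Int.ceil_lt_add_one ((-⌊B⌋ - v : ℝ) / Q)
      have e3 : (-⌊B⌋ - v : ℝ) / Q = -(⌊B⌋ / Q) + -v / Q := by ring
      rw [abs_le]
      constructor <;> linarith
    · rw [sub_nonneg]
      apply Int.ceil_mono
      gcongr
      omega
  · have hs : signedResidues Q true (v : ZMod Q) B =
        (Finset.Ioc 0 ⌊B⌋).filter (· ≡ v [ZMOD Q]) := by
      ext x
      simp only [mem_signedResidues, Finset.mem_filter, Finset.mem_Ioc, hmod, abs_le,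
        decide_eq_true_eq]
      constructor
      · rintro ⟨h1, h2, h3, h4⟩; exact ⟨⟨h3, h1.2⟩, h4⟩
      · rintro ⟨h1, h4⟩; exact ⟨⟨by omega, h1.2⟩, by omega, h1.1, h4⟩
    have hc := Int.Ioc_filter_modEq_card 0 ⌊B⌋ hQ v
    rw [max_eq_left] at hc
    · rw [hs]
      have hc' : (((Finset.Ioc 0 ⌊B⌋).filter (· ≡ v [ZMOD Q])).card : ℝ) =
          (⌊((⌊B⌋ - v : ℤ) : ℚ) / ((Q : ℤ) : ℚ)⌋ : ℝ) -
          (⌊(((0 : ℤ) - v : ℤ) : ℚ) / ((Q : ℤ) : ℚ)⌋ : ℝ) := by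
        have := congrArg (Int.cast : ℤ → ℝ) hc
        push_cast at this ⊢
        exact this
      rw [hc']
      have e1 : (⌊(((0 : ℤ) - v : ℤ) : ℚ) / ((Q : ℤ) : ℚ)⌋) = ⌊(-v : ℝ) / Q⌋ := by
        rw [← Rat.floor_cast (α := ℝ)]; push_cast; simp
      have e2 : (⌊((⌊B⌋ - v : ℤ) : ℚ) / ((Q : ℤ) : ℚ)⌋) = ⌊(⌊B⌋ - v : ℝ) / Q⌋ := by
        rw [← Rat.floor_cast (α := ℝ)]; push_cast; simp
      rw [e1, e2]
      have a1 := Int.floor_le ((-v : ℝ) / Q)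
      have a2 := Int.lt_floor_add_one ((-v : ℝ) / Q)
      have a3 := Int.floor_le ((⌊B⌋ - v : ℝ) / Q)
      have a4 := Int.lt_floor_add_one ((⌊B⌋ - v : ℝ) / Q)
      have e3 : (⌊B⌋ - v : ℝ) / Q = (⌊B⌋ / Q) + -v / Q := by ring
      rw [abs_le]
      constructor <;> linarith
    · rw [sub_nonneg]
      apply Int.floor_mono
      gcongr

lemma tendsto_card_signedResidues_div (Q : ℕ) [NeZero Q] (s : Bool) (r : ZMod Q) :
    Tendsto (fun B : ℝ => ((signedResidues Q s r B).card : ℝ) / B) atTop (𝓝 (1 / Q)) := by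
  rw [tendsto_iff_dist_tendsto_zero]
  refine squeeze_zero' (Eventually.of_forall fun _ => dist_nonneg) ?_
    ((tendsto_const_nhds (x := (2 : ℝ))).div_atTop tendsto_id)
  filter_upwards [eventually_gt_atTop 0] with B hB
  have h := abs_card_signedResidues_sub_le Q s r hB.le
  rw [Real.dist_eq, id, le_div_iff₀ hB]
  calc _ = |((signedResidues Q s r B).card : ℝ) / B - 1 / Q| * |B| := by rw [abs_of_pos hB]
    _ = |((signedResidues Q s r B).card : ℝ) - B / Q| := by
      rw [← abs_mul, sub_mul, div_mul_cancel₀ _ hB.ne', one_div_mul_eq_div]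
    _ ≤ 2 := h

/-- The sign patterns of triples of non-zero numbers that are not all of the same sign. -/
def mixedSigns : Finset (Bool × Bool × Bool) :=
  Finset.univ.filter fun s => ¬(s.1 = s.2.1 ∧ s.2.1 = s.2.2)

lemma card_mixedSigns : mixedSigns.card = 6 := by decide

lemma isAdmissible_iff_mem_mixedSigns (a b c : ℤ) :
    IsAdmissible a b c ↔ (a ≠ 0 ∧ b ≠ 0 ∧ c ≠ 0) ∧
      (decide (0 < a), decide (0 < b), decide (0 < c)) ∈ mixedSigns := by
  simp only [IsAdmissible, mixedSigns, Finset.mem_filter, Finset.mem_univ, true_and,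
    decide_eq_decide]
  refine and_congr_right fun ⟨ha, hb, hc⟩ => ?_
  grind

/-- Reduction of integral coefficient triples modulo `m`. -/
def intReduction (m : ℕ) (t : ℤ × ℤ × ℤ) : ZMod m × ZMod m × ZMod m :=
  (t.1, t.2.1, t.2.2)

lemma mem_familyUpTo_iff {B : ℝ} {t : ℤ × ℤ × ℤ} :
    t ∈ familyUpTo B ↔ IsAdmissible t.1 t.2.1 t.2.2 ∧
      |t.1| ≤ ⌊B⌋ ∧ |t.2.1| ≤ ⌊B⌋ ∧ |t.2.2| ≤ ⌊B⌋ := by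
  simp only [familyUpTo, Set.mem_ofPred_eq, ← Int.le_floor, max_le_iff]

lemma finite_familyUpTo (B : ℝ) : (familyUpTo B).Finite := by
  refine (Finset.finite_toSet (Finset.Icc (-⌊B⌋) ⌊B⌋ ×ˢ Finset.Icc (-⌊B⌋) ⌊B⌋ ×ˢ
    Finset.Icc (-⌊B⌋) ⌊B⌋)).subset fun t ht => ?_
  rw [mem_familyUpTo_iff] at ht
  simp only [Finset.coe_product, Set.mem_prod, Finset.mem_coe, Finset.mem_Icc, ← abs_le]
  exact ht.2

/-- Fixing the sign and the residue class of each coefficient splits the family into disjoint boxes,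
where the coordinates are independent. -/
lemma ncard_familyUpTo_residue (Q : ℕ) (T : Finset (ZMod Q × ZMod Q × ZMod Q)) (B : ℝ) :
    {t | t ∈ familyUpTo B ∧ intReduction Q t ∈ T}.ncard = ∑ s ∈ mixedSigns, ∑ r ∈ T,
      (signedResidues Q s.1 r.1 B).card * ((signedResidues Q s.2.1 r.2.1 B).card *
        (signedResidues Q s.2.2 r.2.2 B).card) := by
  classical
  rw [← Finset.sum_product']
  have : {t | t ∈ familyUpTo B ∧ intReduction Q t ∈ T} =
      (((mixedSigns ×ˢ T).biUnion fun u => signedResidues Q u.1.1 u.2.1 B ×ˢ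
        signedResidues Q u.1.2.1 u.2.2.1 B ×ˢ signedResidues Q u.1.2.2 u.2.2.2 B :
          Finset (ℤ × ℤ × ℤ)) : Set (ℤ × ℤ × ℤ)) := by
    ext ⟨a, b, c⟩
    simp only [Set.mem_ofPred_eq, mem_familyUpTo_iff, isAdmissible_iff_mem_mixedSigns,
      Finset.coe_biUnion, Set.mem_iUnion, Finset.mem_coe, Finset.mem_product, mem_signedResidues,
      intReduction]
    constructor
    · rintro ⟨⟨⟨⟨ha, hb, hc⟩, hs⟩, h1, h2, h3⟩, hT⟩
      exact ⟨((_, _, _), (_, _, _)), ⟨hs, hT⟩, ⟨h1, ha, rfl, rfl⟩, ⟨h2, hb, rfl, rfl⟩,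
        ⟨h3, hc, rfl, rfl⟩⟩
    · rintro ⟨⟨⟨s1, s2, s3⟩, ⟨r1, r2, r3⟩⟩, ⟨hs, hT⟩, ⟨h1, ha, rfl, rfl⟩, ⟨h2, hb, rfl, rfl⟩,
        ⟨h3, hc, rfl, rfl⟩⟩
      exact ⟨⟨⟨⟨ha, hb, hc⟩, hs⟩, h1, h2, h3⟩, hT⟩
  rw [this, Set.ncard_coe_finset, Finset.card_biUnion]
  · simp only [Finset.card_product]
  · rintro ⟨⟨s1, s2, s3⟩, ⟨r1, r2, r3⟩⟩ - ⟨⟨s1', s2', s3'⟩, ⟨r1', r2', r3'⟩⟩ - hne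
    refine Finset.disjoint_left.2 ?_
    rintro ⟨a, b, c⟩ h h'
    simp only [Finset.mem_product, mem_signedResidues] at h h'
    obtain ⟨⟨-, -, rfl, rfl⟩, ⟨-, -, rfl, rfl⟩, ⟨-, -, rfl, rfl⟩⟩ := h
    obtain ⟨⟨-, -, rfl, rfl⟩, ⟨-, -, rfl, rfl⟩, ⟨-, -, rfl, rfl⟩⟩ := h'
    exact hne rfl

lemma tendsto_ncard_familyUpTo_residue (Q : ℕ) [NeZero Q]
    (T : Set (ZMod Q × ZMod Q × ZMod Q)) :
    Tendsto (fun B : ℝ => ({t | t ∈ familyUpTo B ∧ intReduction Q t ∈ T}.ncard : ℝ) / B ^ 3)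
      atTop (𝓝 (6 * (T.ncard / (Q : ℝ) ^ 3))) := by
  classical
  have h : Tendsto (fun B : ℝ => ∑ s ∈ mixedSigns, ∑ r ∈ T.toFinset,
      ((signedResidues Q s.1 r.1 B).card : ℝ) / B * (((signedResidues Q s.2.1 r.2.1 B).card : ℝ) / B *
        (((signedResidues Q s.2.2 r.2.2 B).card : ℝ) / B))) atTop
      (𝓝 (∑ s ∈ mixedSigns, ∑ r ∈ T.toFinset, 1 / (Q : ℝ) * (1 / Q * (1 / Q)))) :=
    tendsto_finsetSum _ fun s _ => tendsto_finsetSum _ fun r _ =>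
      (tendsto_card_signedResidues_div Q _ _).mul ((tendsto_card_signedResidues_div Q _ _).mul
        (tendsto_card_signedResidues_div Q _ _))
  convert h using 2 with B
  · have := ncard_familyUpTo_residue Q T.toFinset B
    simp only [Set.mem_toFinset] at this
    rw [this]
    push_cast
    simp only [Finset.sum_div]
    refine Finset.sum_congr rfl fun s _ => Finset.sum_congr rfl fun r _ => ?_
    ring
  · rw [Finset.sum_const, Finset.sum_const, card_mixedSigns, Set.ncard_eq_toFinset_card']
    simp only [nsmul_eq_mul]
    push_cast
    ring

lemma tendsto_familyCount : Tendsto (fun B : ℝ => (familyCount B : ℝ) / B ^ 3) atTop (𝓝 6) := by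
  have := tendsto_ncard_familyUpTo_residue 1 Set.univ
  simpa [familyCount] using this

/-! ### Independence of coprime moduli -/

section CRT

open scoped Function

/-- The Chinese remainder theorem for triples of residue classes. -/
noncomputable def zmodTripleEquivPi {ι : Type*} [Fintype ι] (a : ι → ℕ)
    (h : Pairwise (Nat.Coprime on a)) :
    ZMod (∏ i, a i) × ZMod (∏ i, a i) × ZMod (∏ i, a i) ≃
      ∀ i, ZMod (a i) × ZMod (a i) × ZMod (a i) where
  toFun t i := (ZMod.prodEquivPi a h t.1 i, ZMod.prodEquivPi a h t.2.1 i,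
    ZMod.prodEquivPi a h t.2.2 i)
  invFun g := ((ZMod.prodEquivPi a h).symm fun i => (g i).1,
    (ZMod.prodEquivPi a h).symm fun i => (g i).2.1, (ZMod.prodEquivPi a h).symm fun i => (g i).2.2)
  left_inv t := by
    refine Prod.ext ?_ (Prod.ext ?_ ?_) <;> exact RingEquiv.symm_apply_apply _ _
  right_inv g := by
    funext i
    simp only [RingEquiv.apply_symm_apply]

lemma zmodTripleEquivPi_intReduction {ι : Type*} [Fintype ι] (a : ι → ℕ)
    (h : Pairwise (Nat.Coprime on a)) (t : ℤ × ℤ × ℤ) (i : ι) :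
    zmodTripleEquivPi a h (intReduction _ t) i = intReduction (a i) t := by
  simp only [zmodTripleEquivPi, intReduction, Equiv.coe_fn_mk, ZMod.prodEquivPi_apply,
    map_intCast]

lemma ncard_univ_pi {ι : Type*} [Fintype ι] {α : ι → Type*} (s : ∀ i, Set (α i)) :
    (Set.univ.pi s).ncard = ∏ i, (s i).ncard := by
  rw [← Nat.card_coe_set_eq, Nat.card_congr (Equiv.Set.univPi s), Nat.card_pi]
  rfl

lemma tendsto_ncard_familyUpTo_residues {ι : Type*} [Fintype ι] (a : ι → ℕ)
    (ha : ∀ i, a i ≠ 0) (h : Pairwise (Nat.Coprime on a))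
    (T : ∀ i, Set (ZMod (a i) × ZMod (a i) × ZMod (a i))) :
    Tendsto (fun B : ℝ => ({t | t ∈ familyUpTo B ∧ ∀ i, intReduction (a i) t ∈ T i}.ncard : ℝ) /
      B ^ 3) atTop (𝓝 (6 * ∏ i, ((T i).ncard / (a i : ℝ) ^ 3))) := by
  have _ : NeZero (∏ i, a i) := ⟨Finset.prod_ne_zero_iff.2 fun i _ => ha i⟩
  have key := tendsto_ncard_familyUpTo_residue (∏ i, a i) (zmodTripleEquivPi a h ⁻¹' Set.univ.pi T)
  have hset : ∀ t, intReduction (∏ i, a i) t ∈ zmodTripleEquivPi a h ⁻¹' Set.univ.pi T ↔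
      ∀ i, intReduction (a i) t ∈ T i := by
    intro t
    simp [zmodTripleEquivPi_intReduction]
  simp only [hset] at key
  convert key using 3
  rw [Finset.prod_div_distrib, Set.ncard_preimage_of_injective_subset_range
    (zmodTripleEquivPi a h).injective (by simp), ncard_univ_pi]
  push_cast
  rw [Finset.prod_pow]

end CRT

/-! ### Solubility at finitely many primes -/

lemma mem_padicSoluble_intCast_iff (p : ℕ) [Fact p.Prime] {n : ℤ} {v : ℕ}
    (hv : ¬ (p : ℤ) ^ (v + 1) ∣ n) (t : ℤ × ℤ × ℤ) :
    ((t.1 : ℤ_[p]), (t.2.1 : ℤ_[p]), (t.2.2 : ℤ_[p])) ∈ padicSoluble p n ↔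
      intReduction (p ^ (v + squareLevel p)) t ∈ solubleMod (p ^ (v + squareLevel p)) n := by
  rw [mem_padicSoluble_iff hv, padicReduction_apply]
  simp only [map_intCast, intReduction]

/-- The surface with coefficients `t` has a point over `ℤ_p`. -/
def LocallySolubleAt (n : ℤ) (p : ℕ) [Fact p.Prime] (t : ℤ × ℤ × ℤ) : Prop :=
  ((t.1 : ℤ_[p]), (t.2.1 : ℤ_[p]), (t.2.2 : ℤ_[p])) ∈ padicSoluble p n

lemma IsAdmissible.intCast {a b c : ℤ} (h : IsAdmissible a b c) :
    IsAdmissible (a : ℝ) (b : ℝ) (c : ℝ) := by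
  simpa [IsAdmissible] using h

lemma nonempty_adelicPoints_iff {n : ℤ} {t : ℤ × ℤ × ℤ} (ht : IsAdmissible t.1 t.2.1 t.2.2) :
    Nonempty (AdelicPoints t.1 t.2.1 t.2.2 n) ↔ ∀ p : Nat.Primes, LocallySolubleAt n p t := by
  rw [nonempty_prod, Classical.nonempty_pi]
  have h := ht.intCast.quadricPoints_nonempty (n : ℝ)
  simp only [Set.nonempty_coe_sort, h, true_and]
  rfl

/-- A crude bound on the valuation of `n`, from `|n| < p ^ (|n| + 1)`; its merit is to give one
exponent for all primes. -/
lemma not_pow_natAbs_succ_dvd {n : ℤ} (hn : n ≠ 0) {p : ℕ} (hp : p.Prime) :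
    ¬ (p : ℤ) ^ (n.natAbs + 1) ∣ n := by
  intro h
  have h1 := Nat.le_of_dvd (Int.natAbs_pos.2 hn) (Int.natAbs_dvd_natAbs.2 h)
  rw [Int.natAbs_pow, Int.natAbs_natCast] at h1
  have h2 := Nat.lt_pow_self hp.one_lt (n := n.natAbs + 1)
  omega

/-- The primes that are at most `M`. -/
def primesLE (M : ℕ) : Finset Nat.Primes := (Finset.range (M + 1)).subtype Nat.Prime

lemma mem_primesLE {M : ℕ} {p : Nat.Primes} : p ∈ primesLE M ↔ (p : ℕ) ≤ M :=
  Finset.mem_subtype.trans (by rw [Finset.mem_range, Nat.lt_succ_iff])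

lemma tendsto_primesLE : Tendsto primesLE atTop atTop := by
  refine tendsto_atTop_finset_of_monotone (fun M N h p hp => ?_) fun p => ⟨p, ?_⟩
  · rw [mem_primesLE] at hp ⊢; omega
  · rw [mem_primesLE]

/-- The number of surfaces of height at most `B` that are soluble at all primes up to `M`. -/
noncomputable def partialLocCount (n : ℤ) (M : ℕ) (B : ℝ) : ℕ :=
  {t | t ∈ familyUpTo B ∧ ∀ p ∈ primesLE M, LocallySolubleAt n p t}.ncard

lemma tendsto_partialLocCount {n : ℤ} (hn : n ≠ 0) (M : ℕ) :
    Tendsto (fun B : ℝ => (partialLocCount n M B : ℝ) / B ^ 3) atTop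
      (𝓝 (6 * ∏ p ∈ primesLE M, sigmaPrime p n)) := by
  have hv := fun p : Nat.Primes => not_pow_natAbs_succ_dvd hn p.2
  have h := tendsto_ncard_familyUpTo_residues
    (fun p : primesLE M => (p.1 : ℕ) ^ (n.natAbs + squareLevel p.1))
    (fun p => pow_ne_zero _ p.1.2.ne_zero)
    (fun p q hpq => Nat.Coprime.pow _ _ ((Nat.coprime_primes p.1.2 q.1.2).2 fun h =>
      hpq (Subtype.ext (Subtype.ext h))))
    (fun p => solubleMod _ n)
  convert h using 2 with B
  · rw [partialLocCount]
    congr 3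
    ext t
    simp only [Set.mem_ofPred_eq, Subtype.forall, LocallySolubleAt,
      mem_padicSoluble_intCast_iff _ (hv _)]
  · rw [← Finset.prod_attach]
    congr 2
    funext p
    rw [sigmaPrime_eq _ (hv _)]
    push_cast
    rfl

/-! ### The contribution of large primes -/

lemma locallySolubleAt_of_not_dvd {n : ℤ} {p : ℕ} [Fact p.Prime] (hp : p ≠ 2)
    (hn : ¬ (p : ℤ) ∣ n) {t : ℤ × ℤ × ℤ}
    (h : ¬ (((p : ℤ) ∣ t.1 ∧ (p : ℤ) ∣ t.2.1) ∨ ((p : ℤ) ∣ t.2.1 ∧ (p : ℤ) ∣ t.2.2) ∨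
      ((p : ℤ) ∣ t.1 ∧ (p : ℤ) ∣ t.2.2))) : LocallySolubleAt n p t := by
  have hs : 0 + squareLevel p = 1 := by simp [squareLevel, hp]
  rw [LocallySolubleAt, mem_padicSoluble_intCast_iff p (v := 0) (by simpa using hn), hs, pow_one]
  simp only [← ZMod.intCast_zmod_eq_zero_iff_dvd] at h
  change (quadricPoints (t.1 : ZMod p) (t.2.1 : ZMod p) (t.2.2 : ZMod p) (n : ZMod p)).Nonempty
  by_cases h1 : (t.1 : ZMod p) = 0
  · rw [quadricPoints_perm]
    exact quadricPoints_nonempty_of_ne_zero hp (by tauto) (by tauto) _ _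
  · by_cases h2 : (t.2.1 : ZMod p) = 0
    · rw [quadricPoints_perm, quadricPoints_perm]
      exact quadricPoints_nonempty_of_ne_zero hp (by tauto) (by tauto) _ _
    · exact quadricPoints_nonempty_of_ne_zero hp h1 h2 _ _

/-- The non-zero multiples of `d` of absolute value at most `B`. -/
noncomputable def multiplesUpTo (B : ℝ) (d : ℕ) : Finset ℤ :=
  (Finset.Icc (-⌊B⌋) ⌊B⌋).filter fun x => x ≠ 0 ∧ (d : ℤ) ∣ x

lemma mem_multiplesUpTo {B : ℝ} {d : ℕ} {x : ℤ} :
    x ∈ multiplesUpTo B d ↔ |x| ≤ ⌊B⌋ ∧ x ≠ 0 ∧ (d : ℤ) ∣ x := by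
  simp [multiplesUpTo, abs_le]

lemma card_multiplesUpTo_le {B : ℝ} (hB : 0 ≤ B) {d : ℕ} (hd : 0 < d) :
    ((multiplesUpTo B d).card : ℝ) ≤ 2 * (B / d) := by
  have hd' : (0 : ℝ) < d := by exact_mod_cast hd
  have hdz : (0 : ℤ) < d := by exact_mod_cast hd
  set m := ⌊B / d⌋ with hm
  have hm0 : 0 ≤ m := Int.floor_nonneg.2 (by positivity)
  have hsub : multiplesUpTo B d ⊆
      ((Finset.Icc (-m) m).erase 0).image fun x => (d : ℤ) * x := by
    intro x hx
    rw [mem_multiplesUpTo] at hx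
    obtain ⟨h1, h2, y, rfl⟩ := hx
    refine Finset.mem_image.2 ⟨y, ?_, rfl⟩
    have hy : |y| ≤ m := by
      rw [hm, Int.le_floor, le_div_iff₀ hd']
      rw [abs_mul, abs_of_pos hdz, Int.le_floor] at h1
      push_cast at h1 ⊢
      linarith
    rw [Finset.mem_erase, Finset.mem_Icc, ← abs_le]
    exact ⟨right_ne_zero_of_mul h2, hy⟩
  have hc := (Finset.card_le_card hsub).trans Finset.card_image_le
  -- Leaving out `0` removes the additive `1`, so the bound stays proportional to `B / d`.
  rw [Finset.card_erase_of_mem (by simpa using hm0), Int.card_Icc] at hc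
  have hc' : ((multiplesUpTo B d).card : ℤ) ≤ 2 * m := by omega
  have hc'' : ((multiplesUpTo B d).card : ℝ) ≤ 2 * m := by exact_mod_cast hc'
  linarith [Int.floor_le (B / d)]

/-- A triple lost beyond `M` has two coefficients divisible by a prime `p > M`, and `p ≤ B` because
they are non-zero. The divisor may range over all integers `d > M`, as `∑ d⁻² ≤ 1 / M`. The constant
is `24 = 3 · 2³`: three pairs of coefficients, and a factor `2` per coordinate for the signs. -/
lemma partialLocCount_le {n : ℤ} (hn : n ≠ 0) {M : ℕ} (hM2 : 2 ≤ M) (hMn : n.natAbs ≤ M) {B : ℝ}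
    (hB : 0 ≤ B) : (partialLocCount n M B : ℝ) ≤ locCount n B + 24 * B ^ 3 / M := by
  classical
  let D := multiplesUpTo B
  let bad : Finset (ℤ × ℤ × ℤ) := (Finset.Ioc M ⌊B⌋₊).biUnion fun d =>
    D d ×ˢ D d ×ˢ D 1 ∪ (D 1 ×ˢ D d ×ˢ D d ∪ D d ×ˢ D 1 ×ˢ D d)
  have hsub : {t | t ∈ familyUpTo B ∧ ∀ p ∈ primesLE M, LocallySolubleAt n p t} ⊆
      {t | t ∈ familyUpTo B ∧ Nonempty (AdelicPoints t.1 t.2.1 t.2.2 n)} ∪ (bad : Set _) := by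
    rintro ⟨a, b, c⟩ ⟨ht, hloc⟩
    by_cases hall : ∀ p : Nat.Primes, LocallySolubleAt n p (a, b, c)
    · exact Or.inl ⟨ht, (nonempty_adelicPoints_iff ht.1).2 hall⟩
    · right
      push Not at hall
      obtain ⟨p, hp⟩ := hall
      have hpM : M < (p : ℕ) := by
        by_contra hle
        exact hp (hloc p (mem_primesLE.2 (by omega)))
      have hdvd := mt (locallySolubleAt_of_not_dvd (p := (p : ℕ)) (by omega) (fun h => by
        have := Nat.le_of_dvd (Int.natAbs_pos.2 hn) (Int.natCast_dvd.1 h)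
        omega)) hp
      rw [not_not] at hdvd
      rw [mem_familyUpTo_iff] at ht
      obtain ⟨⟨⟨ha, hb, hc⟩, -⟩, ha', hb', hc'⟩ := ht
      have hle : ∀ x : ℤ, x ≠ 0 → |x| ≤ ⌊B⌋ → ((p : ℕ) : ℤ) ∣ x → (p : ℕ) ≤ ⌊B⌋₊ := by
        intro x hx h1 h2
        have h3 := Int.le_of_dvd (abs_pos.2 hx) ((dvd_abs _ _).2 h2)
        rw [Nat.le_floor_iff hB]
        have h4 := Int.le_floor.1 (h3.trans h1)
        exact_mod_cast h4
      have hpB : (p : ℕ) ≤ ⌊B⌋₊ := by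
        rcases hdvd with h | h | h
        · exact hle _ ha ha' h.1
        · exact hle _ hb hb' h.1
        · exact hle _ ha ha' h.1
      simp only [bad, D, Finset.coe_biUnion, Set.mem_iUnion, Finset.mem_coe, Finset.mem_union,
        Finset.mem_product, mem_multiplesUpTo, Finset.mem_Ioc, Nat.cast_one, one_dvd, and_true]
      refine ⟨p, ⟨hpM, hpB⟩, ?_⟩
      dsimp only at hdvd
      tauto
  have hfin : ({t | t ∈ familyUpTo B ∧ Nonempty (AdelicPoints t.1 t.2.1 t.2.2 n)} ∪
      (bad : Set (ℤ × ℤ × ℤ))).Finite :=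
    ((finite_familyUpTo B).subset fun t ht => ht.1).union bad.finite_toSet
  have h1 : partialLocCount n M B ≤ locCount n B + bad.card := by
    rw [← Set.ncard_coe_finset bad]
    exact (Set.ncard_le_ncard hsub hfin).trans (Set.ncard_union_le _ _)
  have h2 : (bad.card : ℝ) ≤ ∑ d ∈ Finset.Ioc M ⌊B⌋₊, 24 * B ^ 3 * ((d : ℝ) ^ 2)⁻¹ := by
    calc (bad.card : ℝ) ≤ ∑ d ∈ Finset.Ioc M ⌊B⌋₊, ((D d ×ˢ D d ×ˢ D 1 ∪
          (D 1 ×ˢ D d ×ˢ D d ∪ D d ×ˢ D 1 ×ˢ D d)).card : ℝ) := by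
          exact_mod_cast Finset.card_biUnion_le
      _ ≤ _ := by
        refine Finset.sum_le_sum fun d hd => ?_
        have hd0 : 0 < d := by have := (Finset.mem_Ioc.1 hd).1; omega
        have hd' : (0 : ℝ) < d := by exact_mod_cast hd0
        have c1 : ((D 1).card : ℝ) ≤ 2 * B := by
          simpa using card_multiplesUpTo_le hB one_pos
        have cd : ((D d).card : ℝ) ≤ 2 * (B / d) := card_multiplesUpTo_le hB hd0
        have hu : (D d ×ˢ D d ×ˢ D 1 ∪ (D 1 ×ˢ D d ×ˢ D d ∪ D d ×ˢ D 1 ×ˢ D d)).card ≤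
            3 * ((D d).card * (D d).card * (D 1).card) := by
          refine (Finset.card_union_le _ _).trans
            ((Nat.add_le_add_left (Finset.card_union_le _ _) _).trans (le_of_eq ?_))
          simp only [Finset.card_product]
          ring
        calc _ ≤ ((3 * ((D d).card * (D d).card * (D 1).card) : ℕ) : ℝ) := by exact_mod_cast hu
          _ = 3 * ((D d).card * (D d).card * (D 1).card) := by push_cast; ring
          _ ≤ 3 * ((2 * (B / d)) * (2 * (B / d)) * (2 * B)) := by gcongr
          _ = _ := by field_simp; ring
  have h3 : ∑ d ∈ Finset.Ioc M ⌊B⌋₊, ((d : ℝ) ^ 2)⁻¹ ≤ (M : ℝ)⁻¹ := by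
    rcases le_total M ⌊B⌋₊ with h | h
    · exact (sum_Ioc_inv_sq_le_sub (by omega) h).trans (sub_le_self _ (by positivity))
    · rw [Finset.Ioc_eq_empty_of_le h, Finset.sum_empty]; positivity
  have h4 : (bad.card : ℝ) ≤ 24 * B ^ 3 / M := by
    rw [← Finset.mul_sum] at h2
    rw [div_eq_mul_inv]
    exact h2.trans (mul_le_mul_of_nonneg_left h3 (by positivity))
  have h1' : (partialLocCount n M B : ℝ) ≤ locCount n B + bad.card := by exact_mod_cast h1
  linarith

lemma locCount_le_partialLocCount (n : ℤ) (M : ℕ) (B : ℝ) :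
    locCount n B ≤ partialLocCount n M B := by
  refine Set.ncard_le_ncard ?_ ((finite_familyUpTo B).subset fun t ht => ht.1)
  rintro t ⟨ht, h⟩
  exact ⟨ht, fun p _ => (nonempty_adelicPoints_iff ht.1).1 h p⟩

/-! ### Convergence of the product and the limit -/

lemma summable_abs_sigmaPrime_sub_one {n : ℤ} (hn : n ≠ 0) :
    Summable fun p : Nat.Primes => ‖sigmaPrime p n - 1‖ := by
  have hs : Summable fun p : Nat.Primes => 2 * ((p : ℕ) : ℝ) ^ (-2 : ℝ) :=
    (Nat.Primes.summable_rpow.2 (by norm_num)).mul_left 2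
  refine hs.of_norm_bounded_eventually ?_
  rw [eventually_cofinite]
  -- Beyond `2 + |n|` every prime is odd and prime to `n`, so the explicit formula applies.
  refine (primesLE (2 + n.natAbs)).finite_toSet.subset fun p hp => ?_
  rw [Finset.mem_coe, mem_primesLE]
  by_contra hlt
  refine hp ?_
  rw [sigmaPrime_eq_of_odd_prime _ (by omega) (fun h => by
    have := Nat.le_of_dvd (Int.natAbs_pos.2 hn) (Int.natCast_dvd.1 h)
    omega), norm_norm, Real.norm_eq_abs, Real.rpow_neg (by positivity)]
  have h1 : (1 : ℝ) ≤ (p : ℕ) := by exact_mod_cast p.2.one_lt.le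
  have hq : (0 : ℝ) ≤ ((p : ℕ) : ℝ)⁻¹ := by positivity
  have hq1 : ((p : ℕ) : ℝ)⁻¹ ≤ 1 := inv_le_one_of_one_le₀ h1
  rw [Real.rpow_two, ← inv_pow]
  generalize ((p : ℕ) : ℝ)⁻¹ = q at hq hq1
  rw [abs_le]
  constructor <;> nlinarith [mul_nonneg (sq_nonneg q) hq, mul_nonneg (sq_nonneg q) (sub_nonneg.2 hq1),
    sq_nonneg q]

lemma multipliable_sigmaPrime {n : ℤ} (hn : n ≠ 0) :
    Multipliable fun p : Nat.Primes => sigmaPrime p n := by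
  simpa using multipliable_one_add_of_summable (summable_abs_sigmaPrime_sub_one hn)

lemma tprod_sigmaPrime_ne_zero {n : ℤ} (hn : n ≠ 0) :
    ∏' p : Nat.Primes, sigmaPrime p n ≠ 0 := by
  have := tprod_one_add_ne_zero_of_summable (f := fun p : Nat.Primes => sigmaPrime p n - 1)
    (fun p => by simpa using (sigmaPrime_pos p (not_pow_natAbs_succ_dvd hn p.2)).ne')
    (summable_abs_sigmaPrime_sub_one hn)
  simpa using this

lemma tendsto_locCount {n : ℤ} (hn : n ≠ 0) :
    Tendsto (fun B : ℝ => (locCount n B : ℝ) / B ^ 3) atTop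
      (𝓝 (6 * ∏' p : Nat.Primes, sigmaPrime p n)) := by
  have hprod : Tendsto (fun M : ℕ => 6 * ∏ p ∈ primesLE M, sigmaPrime p n) atTop
      (𝓝 (6 * ∏' p : Nat.Primes, sigmaPrime p n)) :=
    ((multipliable_sigmaPrime hn).hasProd.comp tendsto_primesLE).const_mul 6
  have herr : Tendsto (fun M : ℕ => 24 / (M : ℝ)) atTop (𝓝 0) :=
    tendsto_const_nhds.div_atTop tendsto_natCast_atTop_atTop
  rw [Metric.tendsto_nhds]
  intro ε hε
  -- `M` is fixed before `B` grows: `ε / 3` each for the tail of the product, the large primes and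
  -- the count at level `M`.
  obtain ⟨M, h1, h2, h3, h4⟩ := ((Metric.tendsto_nhds.1 hprod (ε / 3) (by positivity)).and
    ((Metric.tendsto_nhds.1 herr (ε / 3) (by positivity)).and
      ((eventually_ge_atTop 2).and (eventually_ge_atTop n.natAbs)))).exists
  filter_upwards [Metric.tendsto_nhds.1 (tendsto_partialLocCount hn M) (ε / 3) (by positivity),
    eventually_gt_atTop 0] with B h5 hB
  have hB3 : 0 < B ^ 3 := by positivity
  have hup : (locCount n B : ℝ) / B ^ 3 ≤ partialLocCount n M B / B ^ 3 := by
    gcongr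
    exact locCount_le_partialLocCount n M B
  have hlow : (partialLocCount n M B : ℝ) / B ^ 3 ≤ locCount n B / B ^ 3 + 24 / M := by
    rw [div_le_iff₀ hB3, add_mul, div_mul_cancel₀ _ hB3.ne', div_mul_eq_mul_div]
    exact partialLocCount_le hn h3 h4 hB.le
  rw [Real.dist_eq, abs_lt] at h1 h2 h5 ⊢
  constructor <;> linarith [h1.1, h1.2, h2.1, h2.2, h5.1, h5.2]

theorem theorem1p0 (n : ℤ) (hn : n ≠ 0) :
    -- the product of local densities converges, and to a non-zero value
    Multipliable (fun p : Nat.Primes => sigmaPrime p n) ∧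
    sigmaInfty n * ∏' p : Nat.Primes, sigmaPrime p n ≠ 0 ∧
    -- the density of the locally soluble surfaces in the family
    Tendsto (fun B : ℝ => (locCount n B : ℝ) / (familyCount B : ℝ)) atTop
      (𝓝 (sigmaInfty n * ∏' p : Nat.Primes, sigmaPrime p n)) ∧
    -- the limit in terms of the volume of the box that contains the coefficients, which is `6`
    Tendsto (fun B : ℝ => (locCount n B : ℝ) / B ^ 3) atTop
      (𝓝 ((volume admissibleCube).toReal *
        (sigmaInfty n * ∏' p : Nat.Primes, sigmaPrime p n))) ∧
    (volume admissibleCube).toReal = 6 ∧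
    -- the values of the local densities
    sigmaInfty n = 1 ∧
    (∀ p : Nat.Primes, ¬ ((p : ℕ) : ℤ) ∣ n → 2 < (p : ℕ) →
      sigmaPrime p n = 1 - 3 / 2 * ((p : ℕ) : ℝ)⁻¹ ^ 2 + 1 / 2 * ((p : ℕ) : ℝ)⁻¹ ^ 3) ∧
    (Odd n → sigmaPrime 2 n = 357 / 512) := by
  have hloc := tendsto_locCount hn
  rw [volume_admissibleCube, sigmaInfty_eq_one, one_mul]
  refine ⟨multipliable_sigmaPrime hn, tprod_sigmaPrime_ne_zero hn, ?_, hloc, rfl, rfl,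
    fun p hp h2 => sigmaPrime_eq_of_odd_prime p h2.ne' hp, sigmaPrime_two_of_odd⟩
  have h := hloc.div tendsto_familyCount (by norm_num)
  rw [mul_div_cancel_left₀ _ (by norm_num)] at h
  refine h.congr' ?_
  filter_upwards [eventually_gt_atTop 0] with B hB
  exact div_div_div_cancel_right₀ (by positivity) _ _
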